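/- Let $d\ge 0$. For a domain (nonempty connected open set) $D\subset\mathbb C^d$ let $K_D$ be its Kobayashi pseudodistance: $K_D(x,y)$ is the infimum of $\sum_{i=1}^n\rho(a_i,b_i)$ over all finite chains of holomorphic maps $f_1,\dots,f_n:\mathbb D\to D$ and points $a_i,b_i$ of the unit disc $\mathbb D$ with $f_1(a_1)=x$, $f_i(b_i)=f_{i+1}(a_{i+1})$ for $1\le i<n$, and $f_n(b_n)=y$, where $\rho(a,b)=\operatorname{artanh}\left|\frac{a-b}{1-\bar a b}\right|$ is the Poincaré distance. The domain $D$ is called complete hyperbolic if $(D,K_D)$ is a complete metric space. A geodesic segment of $(D,K_D)$ from $x$ to $y$ is the image of a map $\gamma:[0,L]\to D$, $L\ge 0$, with $\gamma(0)=x$, $\gamma(L)=y$ and $K_D(\gamma(s),\gamma(t))=|s-t|$ for all $s,t\in[0,L]$. A couple of points $p\neq q$ of the Euclidean boundary $\partial D$ has the visibility condition with respect to $K_D$ if there are disjoint neighborhoods $V_p$ of $p$ and $V_q$ of $q$ in $\mathbb C^d$ and a compact set $K\subset D$ such that every geodesic segment of $(D,K_D)$ from a point of $V_p\cap D$ to a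 point of $V_q\cap D$ meets $K$. A bounded domain $\Omega\subset\mathbb C^d$ is called locally visible if every $p\in\partial\Omega$ has open neighborhoods $V'\subseteq V$ in $\mathbb C^d$ such that $\Omega\cap V$ is connected and complete hyperbolic, and every couple of distinct points of $\partial\Omega\cap V'$ has the visibility condition with respect to $K_{\Omega\cap V}$. **Lemma.** If a bounded domain $\Omega\subset\mathbb C^d$ is locally visible, then $(\Omega,K_\Omega)$ is complete hyperbolic, that is, a complete metric space. -/

import Mathlib

open scoped ENNReal Topology

noncomputable section

namespace Kobayashi

/-- The Poincaré distance of the open unit disc of `ℂ`, normalized so that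
`poincareDist 0 r = artanh r` for `0 ≤ r < 1`. -/
def poincareDist (a b : ℂ) : ℝ :=
  Real.artanh (‖a - b‖ / ‖1 - starRingEnd ℂ a * b‖)

/-- `f` restricts to a holomorphic map from the open unit disc into `D`. -/
def IsHolomorphicDisc {d : ℕ} (D : Set (EuclideanSpace ℂ (Fin d)))
    (f : ℂ → EuclideanSpace ℂ (Fin d)) : Prop :=
  DifferentiableOn ℂ f (Metric.ball 0 1) ∧ Set.MapsTo f (Metric.ball 0 1) D

/-- The Lempert function of `D`: the infimum of the Poincaré distances of two points `a`, `b` of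
the unit disc over all holomorphic discs in `D` with `f a = x` and `f b = y`
(`⊤` if there is no such disc). -/
def lempert {d : ℕ} (D : Set (EuclideanSpace ℂ (Fin d)))
    (x y : EuclideanSpace ℂ (Fin d)) : ℝ≥0∞ :=
  ⨅ (f : ℂ → EuclideanSpace ℂ (Fin d)) (a : ℂ) (b : ℂ)
    (_ : IsHolomorphicDisc D f ∧ a ∈ Metric.ball (0 : ℂ) 1 ∧ b ∈ Metric.ball (0 : ℂ) 1 ∧
      f a = x ∧ f b = y), ENNReal.ofReal (poincareDist a b)

/-- The Kobayashi pseudodistance `K_D`: the infimum of the lengths of all finite chains of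
holomorphic discs in `D` from `x` to `y`. -/
def kobayashiDist {d : ℕ} (D : Set (EuclideanSpace ℂ (Fin d)))
    (x y : EuclideanSpace ℂ (Fin d)) : ℝ≥0∞ :=
  ⨅ (n : ℕ) (z : ℕ → EuclideanSpace ℂ (Fin d)) (_ : z 0 = x ∧ z n = y),
    ∑ i ∈ Finset.range n, lempert D (z i) (z (i + 1))

/-- `(D, K_D)` is a complete metric space: `K_D` is finite, separates the points of `D`, and
every `K_D`-Cauchy sequence in `D` converges with respect to `K_D` to a point of `D`. (Symmetry
and the triangle inequality hold for every `D`.) -/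
def IsCompleteHyperbolic {d : ℕ} (D : Set (EuclideanSpace ℂ (Fin d))) : Prop :=
  (∀ x ∈ D, ∀ y ∈ D, kobayashiDist D x y ≠ ⊤) ∧
  (∀ x ∈ D, ∀ y ∈ D, kobayashiDist D x y = 0 → x = y) ∧
  ∀ u : ℕ → EuclideanSpace ℂ (Fin d), (∀ n, u n ∈ D) →
    (∀ ε : ℝ≥0∞, 0 < ε → ∃ N : ℕ, ∀ m ≥ N, ∀ n ≥ N, kobayashiDist D (u m) (u n) < ε) →
    ∃ a ∈ D, Filter.Tendsto (fun n => kobayashiDist D (u n) a) Filter.atTop (𝓝 0)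

/-- `S` is (the image of) a geodesic segment `[x, y]_D` for `K_D`, that is, the image of an
isometric embedding `γ` of an interval `[0, L]` into `(D, K_D)` with `γ 0 = x` and `γ L = y`. -/
def IsGeodesicSegment {d : ℕ} (D : Set (EuclideanSpace ℂ (Fin d)))
    (x y : EuclideanSpace ℂ (Fin d)) (S : Set (EuclideanSpace ℂ (Fin d))) : Prop :=
  ∃ (L : ℝ) (γ : ℝ → EuclideanSpace ℂ (Fin d)), 0 ≤ L ∧
    Set.MapsTo γ (Set.Icc 0 L) D ∧ γ 0 = x ∧ γ L = y ∧
    (∀ s ∈ Set.Icc 0 L, ∀ t ∈ Set.Icc 0 L,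
      kobayashiDist D (γ s) (γ t) = ENNReal.ofReal |s - t|) ∧
    S = γ '' Set.Icc 0 L

/-- The couple `(p, q)` has the visibility condition with respect to the geodesics of `K_D`:
there are disjoint neighborhoods of `p` and `q` and a compact subset of `D` that meets every
geodesic segment joining a point of `D` in the first neighborhood to one in the second. -/
def HasVisibility {d : ℕ} (D : Set (EuclideanSpace ℂ (Fin d)))
    (p q : EuclideanSpace ℂ (Fin d)) : Prop :=
  ∃ Vp ∈ 𝓝 p, ∃ Vq ∈ 𝓝 q, Disjoint Vp Vq ∧
    ∃ K : Set (EuclideanSpace ℂ (Fin d)), IsCompact K ∧ K ⊆ D ∧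
      ∀ x ∈ Vp ∩ D, ∀ y ∈ Vq ∩ D, ∀ S : Set (EuclideanSpace ℂ (Fin d)),
        IsGeodesicSegment D x y S → (S ∩ K).Nonempty

/-- `Ω` is locally visible at the boundary point `p`. -/
def IsLocallyVisibleAt {d : ℕ} (Ω : Set (EuclideanSpace ℂ (Fin d)))
    (p : EuclideanSpace ℂ (Fin d)) : Prop :=
  ∃ V : Set (EuclideanSpace ℂ (Fin d)), IsOpen V ∧ p ∈ V ∧
    IsConnected (Ω ∩ V) ∧ IsCompleteHyperbolic (Ω ∩ V) ∧
    ∃ V' : Set (EuclideanSpace ℂ (Fin d)), IsOpen V' ∧ p ∈ V' ∧ V' ⊆ V ∧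
      ∀ q₁ ∈ frontier Ω ∩ V', ∀ q₂ ∈ frontier Ω ∩ V', q₁ ≠ q₂ → HasVisibility (Ω ∩ V) q₁ q₂

/-- `Ω` is locally visible, that is, locally visible at every boundary point. -/
def IsLocallyVisible {d : ℕ} (Ω : Set (EuclideanSpace ℂ (Fin d))) : Prop :=
  ∀ p ∈ frontier Ω, IsLocallyVisibleAt Ω p

end Kobayashi

end

open Metric Set Filter

namespace Kobayashi

variable {d : ℕ}

/-! Completeness of `K_Ω` is a local property at the boundary. As `Ω` is bounded, the Schwarz lemma
bounds Euclidean distance by a multiple of `K_Ω` (`edist_le_mul_kobayashiDist`), so a `K_Ω`-Cauchy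
sequence has a Euclidean limit `p` in the closure. If `p ∈ Ω`, small affine discs give
`K_Ω`-convergence. If `p ∈ ∂Ω`, localization (`exists_kobayashiDist_inter_le`) bounds `K_{Ω ∩ V}` by
a multiple of `K_Ω` at short range near `p`. The tail is then Cauchy in the complete space `Ω ∩ V`,
and its limit there is also a `K_Ω`-limit because `K_Ω ≤ K_{Ω ∩ V}`. -/

/-! ### Elementary estimates on the unit disc. -/

lemma le_two_mul_artanh {t : ℝ} (h0 : 0 ≤ t) (h1 : t < 1) : t ≤ 2 * Real.artanh t := by
  have hpos : 0 < (1 + t) / (1 - t) := div_pos (by linarith) (by linarith)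
  have hlog := Real.one_sub_inv_le_log_of_pos hpos
  have h : t ≤ 1 - ((1 + t) / (1 - t))⁻¹ := by
    rw [inv_div, le_sub_iff_add_le, ← le_sub_iff_add_le', div_le_iff₀ (by linarith)]
    nlinarith
  rw [Real.artanh_eq_half_log ⟨by linarith, h1.le⟩]
  linarith

lemma artanh_le_two_mul {t : ℝ} (h0 : 0 ≤ t) (h1 : t ≤ 1 / 2) : Real.artanh t ≤ 2 * t := by
  have hpos : 0 < (1 + t) / (1 - t) := div_pos (by linarith) (by linarith)
  have hlog := Real.log_le_sub_one_of_pos hpos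
  have h : (1 + t) / (1 - t) ≤ 1 + 4 * t := by
    rw [div_le_iff₀ (by linarith)]
    nlinarith
  rw [Real.artanh_eq_half_log ⟨by linarith, by linarith⟩]
  linarith

/-- This rests on `|1 - āb|² - |a - b|² = (1 - |a|²)(1 - |b|²)`. -/
lemma norm_sub_lt_norm_one_sub_conj_mul {a b : ℂ} (ha : ‖a‖ < 1) (hb : ‖b‖ < 1) :
    ‖a - b‖ < ‖1 - starRingEnd ℂ a * b‖ := by
  refine lt_of_pow_lt_pow_left₀ 2 (norm_nonneg _) ?_
  have ha' : ‖a‖ ^ 2 < 1 := by nlinarith [norm_nonneg a]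
  have hb' : ‖b‖ ^ 2 < 1 := by nlinarith [norm_nonneg b]
  rw [← Complex.normSq_eq_norm_sq, Complex.normSq_apply] at *
  rw [← Complex.normSq_eq_norm_sq, Complex.normSq_apply] at *
  simp only [Complex.sub_re, Complex.sub_im, Complex.mul_re, Complex.mul_im, Complex.conj_re,
    Complex.conj_im, Complex.one_re, Complex.one_im]
  nlinarith [mul_pos (sub_pos.2 ha') (sub_pos.2 hb')]

lemma poincareDist_comm (a b : ℂ) : poincareDist a b = poincareDist b a := by
  have h : ‖1 - starRingEnd ℂ a * b‖ = ‖1 - starRingEnd ℂ b * a‖ := by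
    rw [← Complex.norm_conj]
    simp [mul_comm]
  rw [poincareDist, poincareDist, norm_sub_rev, h]

/-! ### Discs, chains and monotonicity. -/

/-- Every disc can be recentred by a Möbius transformation, so that the Lempert function is
computed by discs through `x` at the origin. -/
lemma exists_centered_disc_of_lempert_lt {D : Set (EuclideanSpace ℂ (Fin d))}
    {x y : EuclideanSpace ℂ (Fin d)} {ε : ℝ≥0∞} (h : lempert D x y < ε) :
    ∃ (g : ℂ → EuclideanSpace ℂ (Fin d)) (w : ℂ), IsHolomorphicDisc D g ∧ ‖w‖ < 1 ∧
      g 0 = x ∧ g w = y ∧ ENNReal.ofReal (Real.artanh ‖w‖) < ε := by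
  simp only [lempert, iInf_lt_iff] at h
  obtain ⟨f, a, b, ⟨⟨hf, hfD⟩, ha, hb, rfl, rfl⟩, hlt⟩ := h
  rw [mem_ball_zero_iff] at ha hb
  have hden : ∀ ζ : ℂ, ‖ζ‖ < 1 → 1 + starRingEnd ℂ a * ζ ≠ 0 := fun ζ hζ h0 ↦ by
    have := norm_sub_lt_norm_one_sub_conj_mul ha (b := -ζ) (by simpa using hζ)
    rw [mul_neg, sub_neg_eq_add, sub_neg_eq_add, h0, norm_zero] at this
    exact this.not_ge (norm_nonneg _)
  have hab := norm_sub_lt_norm_one_sub_conj_mul ha hb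
  have hab0 : 0 < ‖1 - starRingEnd ℂ a * b‖ := (norm_nonneg _).trans_lt hab
  have hab0' := norm_pos_iff.1 hab0
  have hφ : MapsTo (fun ζ : ℂ ↦ (ζ + a) / (1 + starRingEnd ℂ a * ζ)) (ball 0 1) (ball 0 1) := by
    intro ζ hζ
    rw [mem_ball_zero_iff] at hζ ⊢
    have := norm_sub_lt_norm_one_sub_conj_mul ha (b := -ζ) (by simpa using hζ)
    rw [mul_neg, sub_neg_eq_add, sub_neg_eq_add, add_comm a] at this
    rw [norm_div, div_lt_one ((norm_nonneg _).trans_lt this)]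
    exact this
  have hw : ‖(b - a) / (1 - starRingEnd ℂ a * b)‖ =
      ‖a - b‖ / ‖1 - starRingEnd ℂ a * b‖ := by rw [norm_div, norm_sub_rev]
  have hw1 : ‖(b - a) / (1 - starRingEnd ℂ a * b)‖ < 1 := by rwa [hw, div_lt_one hab0]
  refine ⟨fun ζ ↦ f ((ζ + a) / (1 + starRingEnd ℂ a * ζ)),
    (b - a) / (1 - starRingEnd ℂ a * b), ⟨?_, hfD.comp hφ⟩, hw1, by simp, ?_, ?_⟩
  · refine hf.comp (DifferentiableOn.div (by fun_prop) (by fun_prop) fun ζ hζ ↦ ?_) hφ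
    exact hden ζ (mem_ball_zero_iff.1 hζ)
  · have h2 := hden _ hw1
    change f _ = f b
    congr 1
    rw [div_eq_iff h2]
    linear_combination div_mul_cancel₀ (b - a) hab0'
  · rw [hw]
    exact hlt

lemma lempert_le_of_disc {D : Set (EuclideanSpace ℂ (Fin d))}
    {g : ℂ → EuclideanSpace ℂ (Fin d)} {w : ℂ} (hg : IsHolomorphicDisc D g) (hw : ‖w‖ < 1) :
    lempert D (g 0) (g w) ≤ ENNReal.ofReal (Real.artanh ‖w‖) := by
  refine iInf_le_of_le g <| iInf_le_of_le 0 <| iInf_le_of_le w <|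
    iInf_le_of_le ⟨hg, by simp, by simpa using hw, rfl, rfl⟩ ?_
  simp [poincareDist]

lemma lempert_comm (D : Set (EuclideanSpace ℂ (Fin d))) (x y : EuclideanSpace ℂ (Fin d)) :
    lempert D x y = lempert D y x := by
  have key : ∀ x y, lempert D x y ≤ lempert D y x := fun x y ↦ by
    refine le_iInf fun f ↦ le_iInf fun a ↦ le_iInf fun b ↦ le_iInf fun h ↦ ?_
    rw [poincareDist_comm]
    exact iInf_le_of_le f <| iInf_le_of_le b <| iInf_le_of_le a <|
      iInf_le_of_le ⟨h.1, h.2.2.1, h.2.1, h.2.2.2.2, h.2.2.2.1⟩ le_rfl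
  exact le_antisymm (key x y) (key y x)

lemma lempert_anti {D D' : Set (EuclideanSpace ℂ (Fin d))} (h : D ⊆ D')
    (x y : EuclideanSpace ℂ (Fin d)) : lempert D' x y ≤ lempert D x y :=
  le_iInf fun f ↦ le_iInf fun a ↦ le_iInf fun b ↦ le_iInf fun hf ↦
    iInf_le_of_le f <| iInf_le_of_le a <| iInf_le_of_le b <|
      iInf_le_of_le ⟨⟨hf.1.1, hf.1.2.mono_right h⟩, hf.2⟩ le_rfl

lemma kobayashiDist_anti {D D' : Set (EuclideanSpace ℂ (Fin d))} (h : D ⊆ D')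
    (x y : EuclideanSpace ℂ (Fin d)) : kobayashiDist D' x y ≤ kobayashiDist D x y :=
  iInf_mono fun _ ↦ iInf_mono fun _ ↦ iInf_mono fun _ ↦
    Finset.sum_le_sum fun _ _ ↦ lempert_anti h _ _

lemma kobayashiDist_le_sum (D : Set (EuclideanSpace ℂ (Fin d)))
    (z : ℕ → EuclideanSpace ℂ (Fin d)) (n : ℕ) :
    kobayashiDist D (z 0) (z n) ≤ ∑ i ∈ Finset.range n, lempert D (z i) (z (i + 1)) :=
  iInf_le_of_le n <| iInf_le_of_le z <| iInf_le_of_le ⟨rfl, rfl⟩ le_rfl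

lemma exists_chain_of_kobayashiDist_lt {D : Set (EuclideanSpace ℂ (Fin d))}
    {x y : EuclideanSpace ℂ (Fin d)} {ε : ℝ≥0∞} (h : kobayashiDist D x y < ε) :
    ∃ (n : ℕ) (z : ℕ → EuclideanSpace ℂ (Fin d)), z 0 = x ∧ z n = y ∧
      ∑ i ∈ Finset.range n, lempert D (z i) (z (i + 1)) < ε := by
  simp only [kobayashiDist, iInf_lt_iff] at h
  obtain ⟨n, z, ⟨h0, hn⟩, hlt⟩ := h
  exact ⟨n, z, h0, hn, hlt⟩

lemma kobayashiDist_le_lempert (D : Set (EuclideanSpace ℂ (Fin d)))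
    (x y : EuclideanSpace ℂ (Fin d)) : kobayashiDist D x y ≤ lempert D x y := by
  simpa using kobayashiDist_le_sum D (fun i ↦ if i = 0 then x else y) 1

lemma kobayashiDist_ne_top_trans {D : Set (EuclideanSpace ℂ (Fin d))}
    {x y z : EuclideanSpace ℂ (Fin d)} (hxy : kobayashiDist D x y ≠ ⊤)
    (hyz : kobayashiDist D y z ≠ ⊤) : kobayashiDist D x z ≠ ⊤ := by
  obtain ⟨n, u, rfl, rfl, hu⟩ := exists_chain_of_kobayashiDist_lt hxy.lt_top
  obtain ⟨m, v, hv0, rfl, hv⟩ := exists_chain_of_kobayashiDist_lt hyz.lt_top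
  -- Concatenated chain. Index `n` takes its value from `u`, so the first link of the second half
  -- starts at `u n`, which equals `v 0`.
  have h := kobayashiDist_le_sum D (fun i ↦ if i ≤ n then u i else v (i - n)) (n + m)
  have hend : (if n + m ≤ n then u (n + m) else v (n + m - n)) = v m := by
    split_ifs with hm
    · obtain rfl : m = 0 := by omega
      exact hv0.symm
    · simp
  simp only [hend, zero_le, if_true] at h
  refine (h.trans_lt ?_).ne
  rw [Finset.sum_range_add, ENNReal.add_lt_top]
  constructor
  · refine lt_of_eq_of_lt (Finset.sum_congr rfl fun i hi ↦ ?_) hu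
    have := Finset.mem_range.1 hi
    rw [if_pos (by omega), if_pos (by omega)]
  · refine lt_of_eq_of_lt (Finset.sum_congr rfl fun i _ ↦ ?_) hv
    rw [if_neg (by omega : ¬ n + i + 1 ≤ n), show n + i + 1 - n = i + 1 by omega]
    split_ifs with hi
    · obtain rfl : i = 0 := by omega
      rw [hv0, add_zero]
    · rw [show n + i - n = i by omega]

/-! ### Comparison with the Euclidean distance. -/

/-- The affine disc of radius `s` around `x` bounds the Lempert function near `x` linearly. -/
lemma lempert_le_of_ball_subset {D : Set (EuclideanSpace ℂ (Fin d))}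
    {x y : EuclideanSpace ℂ (Fin d)} {s : ℝ} (hs : 0 < s) (hD : ball x s ⊆ D)
    (hy : ‖y - x‖ ≤ s / 2) : lempert D x y ≤ ENNReal.ofReal (2 / s * ‖y - x‖) := by
  -- The radius-`s` disc in the direction of `y`, reaching `y` at `ζ = ‖y - x‖ / s`. For `y = x` it
  -- is constant.
  set g : ℂ → EuclideanSpace ℂ (Fin d) :=
    fun ζ ↦ x + ζ • ((s / ‖y - x‖ : ℝ) : ℂ) • (y - x) with hgdef
  have hhalf : ‖y - x‖ / s ≤ 1 / 2 := by rw [div_le_iff₀ hs]; linarith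
  have hnorm : ‖(((‖y - x‖ / s : ℝ)) : ℂ)‖ = ‖y - x‖ / s := by
    rw [Complex.norm_real, Real.norm_of_nonneg (by positivity)]
  have hg : IsHolomorphicDisc D g := by
    refine ⟨by fun_prop, fun ζ hζ ↦ hD ?_⟩
    rw [mem_ball_zero_iff] at hζ
    rw [mem_ball_iff_norm, hgdef]
    simp only [add_sub_cancel_left, norm_smul, Complex.norm_real, Real.norm_eq_abs]
    rw [abs_of_nonneg (by positivity)]
    have : s / ‖y - x‖ * ‖y - x‖ ≤ s := by
      rw [div_mul_eq_mul_div, mul_div_assoc]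
      exact mul_le_of_le_one_right hs.le (div_self_le_one _)
    nlinarith [norm_nonneg ζ]
  have h0 : g 0 = x := by simp [hgdef]
  have h1 : g ((‖y - x‖ / s : ℝ) : ℂ) = y := by
    rcases eq_or_ne (y - x) 0 with h | h
    · simp [hgdef, ← sub_eq_zero.1 h]
    · have h' := norm_ne_zero_iff.2 h
      simp only [hgdef]
      rw [smul_smul, ← Complex.ofReal_mul, div_mul_div_cancel₀ hs.ne', div_self h']
      simp
  have := lempert_le_of_disc hg (w := ((‖y - x‖ / s : ℝ) : ℂ)) (by rw [hnorm]; linarith)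
  rw [h0, h1, hnorm] at this
  refine this.trans (ENNReal.ofReal_le_ofReal ?_)
  exact (artanh_le_two_mul (by positivity) hhalf).trans_eq (by ring)

/-- Schwarz lemma for discs in a set of diameter at most `M`. -/
lemma IsHolomorphicDisc.norm_sub_le {D : Set (EuclideanSpace ℂ (Fin d))} {M : ℝ}
    (hM : ∀ x ∈ D, ∀ y ∈ D, dist x y ≤ M) {g : ℂ → EuclideanSpace ℂ (Fin d)}
    (hg : IsHolomorphicDisc D g) {w : ℂ} (hw : ‖w‖ < 1) : dist (g w) (g 0) ≤ M * ‖w‖ := by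
  have := Complex.dist_le_div_mul_dist_of_mapsTo_ball (R₂ := M) hg.1
    (fun ζ hζ ↦ mem_closedBall.2 (hM _ (hg.2 hζ) _ (hg.2 (by simp)))) (mem_ball_zero_iff.2 hw)
  simpa using this

/-- On a centred disc, Schwarz gives `M‖w‖`, and `‖w‖ ≤ 2 artanh ‖w‖` accounts for the factor `2M`.
-/
lemma edist_le_mul_lempert {D : Set (EuclideanSpace ℂ (Fin d))} {M : ℝ} (hM0 : 0 < M)
    (hM : ∀ x ∈ D, ∀ y ∈ D, dist x y ≤ M) (x y : EuclideanSpace ℂ (Fin d)) :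
    edist x y ≤ ENNReal.ofReal (2 * M) * lempert D x y := by
  have hk : ENNReal.ofReal (2 * M) ≠ 0 := by simpa using hM0
  rw [← ENNReal.div_le_iff' hk ENNReal.ofReal_ne_top]
  by_contra! h
  obtain ⟨g, w, hg, hw, rfl, rfl, hlt⟩ := exists_centered_disc_of_lempert_lt h
  rw [ENNReal.lt_div_iff_mul_lt (.inl hk) (.inl ENNReal.ofReal_ne_top),
    ← ENNReal.ofReal_mul' (by positivity), edist_comm, edist_dist] at hlt
  refine hlt.not_ge (ENNReal.ofReal_le_ofReal ((hg.norm_sub_le hM hw).trans ?_))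
  nlinarith [le_two_mul_artanh (norm_nonneg w) hw]

lemma edist_le_mul_sum_lempert {D : Set (EuclideanSpace ℂ (Fin d))} {M : ℝ} (hM0 : 0 < M)
    (hM : ∀ x ∈ D, ∀ y ∈ D, dist x y ≤ M) (z : ℕ → EuclideanSpace ℂ (Fin d)) (n : ℕ) :
    edist (z 0) (z n) ≤
      ENNReal.ofReal (2 * M) * ∑ i ∈ Finset.range n, lempert D (z i) (z (i + 1)) := by
  refine (edist_le_range_sum_edist z n).trans ?_
  rw [Finset.mul_sum]
  exact Finset.sum_le_sum fun i _ ↦ edist_le_mul_lempert hM0 hM _ _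

lemma edist_le_mul_kobayashiDist {D : Set (EuclideanSpace ℂ (Fin d))} {M : ℝ} (hM0 : 0 < M)
    (hM : ∀ x ∈ D, ∀ y ∈ D, dist x y ≤ M) (x y : EuclideanSpace ℂ (Fin d)) :
    edist x y ≤ ENNReal.ofReal (2 * M) * kobayashiDist D x y := by
  have hk : ENNReal.ofReal (2 * M) ≠ 0 := by simpa using hM0
  rw [← ENNReal.div_le_iff' hk ENNReal.ofReal_ne_top]
  refine le_iInf fun n ↦ le_iInf fun z ↦ le_iInf ?_
  rintro ⟨rfl, rfl⟩
  rw [ENNReal.div_le_iff' hk ENNReal.ofReal_ne_top]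
  exact edist_le_mul_sum_lempert hM0 hM z n

/-! ### Localization. -/

/-- Localization of the Lempert function: a disc in `D` centred at a point that is deep inside `V`
stays in `V` after shrinking by the factor `s / (s + M)`. -/
lemma lempert_inter_le {D V : Set (EuclideanSpace ℂ (Fin d))} {M s : ℝ} (hM0 : 0 < M)
    (hM : ∀ x ∈ D, ∀ y ∈ D, dist x y ≤ M) (hs : 0 < s) {x y : EuclideanSpace ℂ (Fin d)}
    (hx : ball x s ⊆ V) (h : lempert D x y < ENNReal.ofReal (s / (s + M) / 4)) :
    lempert (D ∩ V) x y ≤ ENNReal.ofReal (4 / (s / (s + M))) * lempert D x y := by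
  have hr : 0 < s / (s + M) := by positivity
  have hr1 : s / (s + M) < 1 := (div_lt_one (by positivity)).2 (by linarith)
  -- By Schwarz, `ζ ↦ g (rζ)` with `r = s / (s + M)` moves less than `s` from its centre, hence
  -- stays in `V`.
  have hrM : M * (s / (s + M)) < s := by
    rw [mul_div_assoc', div_lt_iff₀ (by positivity)]
    nlinarith [mul_pos hs hs]
  generalize s / (s + M) = r at *
  have hk : ENNReal.ofReal (4 / r) ≠ 0 := by simpa using hr
  rw [← ENNReal.div_le_iff' hk ENNReal.ofReal_ne_top]
  by_contra! hcon
  obtain ⟨g, w, hg, hw, rfl, rfl, hlt⟩ := exists_centered_disc_of_lempert_lt (lt_min hcon h)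
  obtain ⟨hlt1, hlt2⟩ := lt_min_iff.1 hlt
  have hart := le_two_mul_artanh (norm_nonneg w) hw
  rw [ENNReal.ofReal_lt_ofReal_iff (by positivity)] at hlt2
  rw [ENNReal.lt_div_iff_mul_lt (.inl hk) (.inl ENNReal.ofReal_ne_top),
    ← ENNReal.ofReal_mul' (by positivity)] at hlt1
  have hnr : ∀ ζ : ℂ, ‖(r : ℂ) * ζ‖ = r * ‖ζ‖ := fun ζ ↦ by
    rw [norm_mul, Complex.norm_real, Real.norm_of_nonneg hr.le]
  have hmaps : MapsTo (fun ζ : ℂ ↦ (r : ℂ) * ζ) (ball 0 1) (ball 0 1) := fun ζ hζ ↦ by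
    rw [mem_ball_zero_iff] at hζ ⊢
    rw [hnr]
    nlinarith [norm_nonneg ζ]
  have hG : IsHolomorphicDisc (D ∩ V) (fun ζ ↦ g ((r : ℂ) * ζ)) := by
    refine ⟨hg.1.comp (by fun_prop) hmaps, fun ζ hζ ↦ ⟨hg.2 (hmaps hζ), hx ?_⟩⟩
    have h1 := hg.norm_sub_le hM (mem_ball_zero_iff.1 (hmaps hζ))
    rw [mem_ball_zero_iff] at hζ
    rw [hnr] at h1
    rw [mem_ball]
    nlinarith [norm_nonneg ζ, mul_pos hM0 hr]
  have hwr : ‖w / (r : ℂ)‖ = ‖w‖ / r := by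
    rw [norm_div, Complex.norm_real, Real.norm_of_nonneg hr.le]
  -- The bound `r / 4` on the Lempert function forces `‖w‖ < r / 2`, so the new parameter `w / r`
  -- lies where `artanh t ≤ 2t`.
  have hhalf : ‖w‖ / r ≤ 1 / 2 := by rw [div_le_iff₀ hr]; linarith
  have hle := lempert_le_of_disc hG (w := w / (r : ℂ)) (by rw [hwr]; linarith)
  have hrc : (r : ℂ) ≠ 0 := by exact_mod_cast hr.ne'
  rw [hwr, mul_zero, mul_div_cancel₀ w hrc] at hle
  refine (hlt1.trans_le hle).not_ge (ENNReal.ofReal_le_ofReal ?_)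
  refine (artanh_le_two_mul (by positivity) hhalf).trans ?_
  rw [mul_div_assoc', mul_div_right_comm]
  calc 2 / r * ‖w‖ ≤ 2 / r * (2 * Real.artanh ‖w‖) := by gcongr
    _ = Real.artanh ‖w‖ * (4 / r) := by ring

/-- Localization of the Kobayashi pseudodistance of a bounded set. -/
lemma exists_kobayashiDist_inter_le {D V : Set (EuclideanSpace ℂ (Fin d))} {M s : ℝ}
    (hM0 : 0 < M) (hM : ∀ x ∈ D, ∀ y ∈ D, dist x y ≤ M) (hs : 0 < s) :
    ∃ η : ℝ≥0∞, 0 < η ∧ ∃ k : ℝ≥0∞, k ≠ 0 ∧ k ≠ ⊤ ∧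
      ∀ x y : EuclideanSpace ℂ (Fin d), ball x (2 * s) ⊆ V → kobayashiDist D x y < η →
        kobayashiDist (D ∩ V) x y ≤ k * kobayashiDist D x y := by
  have hr : 0 < s / (s + M) := by positivity
  have hk : ENNReal.ofReal (4 / (s / (s + M))) ≠ 0 := by
    rw [Ne, ENNReal.ofReal_eq_zero, not_le]
    positivity
  have hM' : ENNReal.ofReal (2 * M) ≠ 0 := by simpa using hM0
  -- The first bound makes every link short enough for `lempert_inter_le`. The second keeps the
  -- whole chain within Euclidean distance `s` of `x`, so each vertex still has its `s`-ball in `V`.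
  refine ⟨min (ENNReal.ofReal (s / (s + M) / 4)) (ENNReal.ofReal s / ENNReal.ofReal (2 * M)),
    lt_min (by rw [ENNReal.ofReal_pos]; positivity)
      (ENNReal.div_pos (by simpa using hs) ENNReal.ofReal_ne_top),
    ENNReal.ofReal (4 / (s / (s + M))), hk, ENNReal.ofReal_ne_top, fun x y hx h ↦ ?_⟩
  rw [← ENNReal.div_le_iff' hk ENNReal.ofReal_ne_top]
  by_contra! hcon
  obtain ⟨n, z, rfl, rfl, hlt⟩ := exists_chain_of_kobayashiDist_lt (lt_min hcon h)
  simp only [lt_min_iff] at hlt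
  obtain ⟨hlt1, hlt2, hlt3⟩ := hlt
  have hball : ∀ i ∈ Finset.range n, ball (z i) s ⊆ V := fun i hi ↦ by
    refine (ball_subset_ball' ?_).trans hx
    have h1 := edist_le_mul_sum_lempert hM0 hM z i
    have h2 : ∑ j ∈ Finset.range i, lempert D (z j) (z (j + 1)) ≤
        ∑ j ∈ Finset.range n, lempert D (z j) (z (j + 1)) :=
      Finset.sum_le_sum_of_subset (Finset.range_mono (Finset.mem_range.1 hi).le)
    rw [ENNReal.lt_div_iff_mul_lt (.inl hM') (.inl ENNReal.ofReal_ne_top), mul_comm] at hlt3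
    have h3 := (h1.trans (mul_le_mul_right h2 _)).trans hlt3.le
    rw [edist_dist, ENNReal.ofReal_le_ofReal_iff hs.le, dist_comm] at h3
    linarith
  rw [ENNReal.lt_div_iff_mul_lt (.inl hk) (.inl ENNReal.ofReal_ne_top), mul_comm,
    Finset.mul_sum] at hlt1
  refine hlt1.not_ge ((kobayashiDist_le_sum _ z n).trans (Finset.sum_le_sum fun i hi ↦ ?_))
  exact lempert_inter_le hM0 hM hs (hball i hi)
    ((Finset.single_le_sum_of_canonicallyOrdered (f := fun j ↦ lempert D (z j) (z (j + 1)))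
      hi).trans_lt hlt2)

/-! ### Finiteness and completeness. -/

lemma tendsto_lempert_of_isOpen {D : Set (EuclideanSpace ℂ (Fin d))} (hD : IsOpen D)
    {x : EuclideanSpace ℂ (Fin d)} (hx : x ∈ D) : Tendsto (lempert D x) (𝓝 x) (𝓝 0) := by
  obtain ⟨s, hs, hsD⟩ := Metric.isOpen_iff.1 hD x hx
  have hlim : Tendsto (fun y ↦ ENNReal.ofReal (2 / s * ‖y - x‖)) (𝓝 x) (𝓝 0) := by
    have : Continuous fun y : EuclideanSpace ℂ (Fin d) ↦ ENNReal.ofReal (2 / s * ‖y - x‖) := by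
      exact ENNReal.continuous_ofReal.comp (by fun_prop)
    simpa using this.tendsto x
  refine tendsto_of_tendsto_of_tendsto_of_le_of_le' tendsto_const_nhds hlim
    (Eventually.of_forall fun _ ↦ zero_le) ?_
  filter_upwards [closedBall_mem_nhds x (half_pos hs)] with y hy
  exact lempert_le_of_ball_subset hs hsD (mem_closedBall_iff_norm.1 hy)

/-- Being at finite distance is transitive and, by small affine discs, holds locally; connectedness
does the rest. -/
lemma kobayashiDist_ne_top {D : Set (EuclideanSpace ℂ (Fin d))} (hD : IsOpen D)
    (hconn : IsPreconnected D) {x y : EuclideanSpace ℂ (Fin d)} (hx : x ∈ D) (hy : y ∈ D) :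
    kobayashiDist D x y ≠ ⊤ := by
  refine hconn.induction₂' (fun x y ↦ kobayashiDist D x y ≠ ⊤) (fun x hx ↦ ?_)
    (fun x y z _ _ _ h h' ↦ kobayashiDist_ne_top_trans h h') hx hy
  have h := (tendsto_lempert_of_isOpen hD hx).eventually (gt_mem_nhds ENNReal.zero_lt_top)
  filter_upwards [nhdsWithin_le_nhds h] with y hy
  exact ⟨((kobayashiDist_le_lempert D x y).trans_lt hy).ne,
    ((kobayashiDist_le_lempert D y x).trans_lt (by rwa [lempert_comm])).ne⟩

/-- A bounded domain that is complete hyperbolic near each of its boundary points is complete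
hyperbolic. -/
theorem isCompleteHyperbolic_of_local {Ω : Set (EuclideanSpace ℂ (Fin d))} (hopen : IsOpen Ω)
    (hconn : IsPreconnected Ω) (hbdd : Bornology.IsBounded Ω)
    (hloc : ∀ p ∈ frontier Ω, ∃ V ∈ 𝓝 p, IsCompleteHyperbolic (Ω ∩ V)) :
    IsCompleteHyperbolic Ω := by
  obtain ⟨C, hC⟩ := Metric.isBounded_iff.1 hbdd
  obtain ⟨M, hM0, hM⟩ : ∃ M : ℝ, 0 < M ∧ ∀ x ∈ Ω, ∀ y ∈ Ω, dist x y ≤ M :=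
    ⟨max C 1, by positivity, fun x hx y hy ↦ (hC hx hy).trans (le_max_left _ _)⟩
  have hM' : ENNReal.ofReal (2 * M) ≠ 0 := by simpa using hM0
  refine ⟨fun x hx y hy ↦ kobayashiDist_ne_top hopen hconn hx hy, fun x _ y _ h ↦ ?_,
    fun u hu hcau ↦ ?_⟩
  · have := edist_le_mul_kobayashiDist hM0 hM x y
    rw [h, mul_zero] at this
    exact edist_le_zero.1 this
  · have hcu : CauchySeq u := by
      refine EMetric.cauchySeq_iff.2 fun ε hε ↦ ?_
      obtain ⟨N, hN⟩ := hcau (ε / ENNReal.ofReal (2 * M))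
        (ENNReal.div_pos hε.ne' ENNReal.ofReal_ne_top)
      refine ⟨N, fun m hm n hn ↦ (edist_le_mul_kobayashiDist hM0 hM _ _).trans_lt ?_⟩
      have := hN m hm n hn
      rwa [ENNReal.lt_div_iff_mul_lt (.inl hM') (.inl ENNReal.ofReal_ne_top), mul_comm] at this
    obtain ⟨p, hp⟩ := cauchySeq_tendsto_of_complete hcu
    by_cases hpΩ : p ∈ Ω
    · refine ⟨p, hpΩ, tendsto_of_tendsto_of_tendsto_of_le_of_le tendsto_const_nhds
        ((tendsto_lempert_of_isOpen hopen hpΩ).comp hp) (fun _ ↦ zero_le) fun n ↦ ?_⟩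
      exact (kobayashiDist_le_lempert _ _ _).trans_eq (lempert_comm _ _ _)
    have hpf : p ∈ frontier Ω := by
      rw [hopen.frontier_eq]
      exact ⟨mem_closure_of_tendsto hp (Eventually.of_forall hu), hpΩ⟩
    obtain ⟨V, hV, hVc⟩ := hloc p hpf
    obtain ⟨s, hs, hsV⟩ := Metric.mem_nhds_iff.1 hV
    obtain ⟨η, hη, k, hk0, hk, hle⟩ :=
      -- With `s / 4` the lemma needs balls of radius `s / 2` in `V`, available once `u n` is within
      -- `s / 2` of `p`.
      exists_kobayashiDist_inter_le (V := V) hM0 hM (s := s / 4) (by positivity)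
    obtain ⟨N, hN⟩ := eventually_atTop.1 (hp.eventually (ball_mem_nhds p (half_pos hs)))
    have hball : ∀ n ≥ N, ball (u n) (2 * (s / 4)) ⊆ V := fun n hn ↦ by
      refine (ball_subset_ball' ?_).trans hsV
      linarith [mem_ball.1 (hN n hn)]
    obtain ⟨a, ha, hlim⟩ := hVc.2.2 (fun n ↦ u (n + N))
      (fun n ↦ ⟨hu _, hball _ (by omega) (mem_ball_self (by positivity))⟩) fun ε hε ↦ by
        -- Below `η` localization applies; below `ε / k` it yields a local distance less than `ε`.
        obtain ⟨N', hN'⟩ := hcau (min η (ε / k)) (lt_min hη (ENNReal.div_pos hε.ne' hk))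
        refine ⟨N', fun m hm n hn ↦ ?_⟩
        have h := lt_min_iff.1 (hN' (m + N) (by omega) (n + N) (by omega))
        refine (hle _ _ (hball _ (by omega)) h.1).trans_lt ?_
        have h2 := h.2
        rwa [ENNReal.lt_div_iff_mul_lt (.inl hk0) (.inl hk), mul_comm] at h2
    refine ⟨a, ha.1, (tendsto_add_atTop_iff_nat N).1 ?_⟩
    exact tendsto_of_tendsto_of_tendsto_of_le_of_le tendsto_const_nhds hlim
      (fun _ ↦ zero_le) fun n ↦ kobayashiDist_anti inter_subset_left _ _

end Kobayashi

theorem lemma2p6 {d : ℕ} (Ω : Set (EuclideanSpace ℂ (Fin d)))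
    (hopen : IsOpen Ω) (hconn : IsConnected Ω) (hbdd : Bornology.IsBounded Ω)
    (hvis : Kobayashi.IsLocallyVisible Ω) :
    Kobayashi.IsCompleteHyperbolic Ω := by
  refine Kobayashi.isCompleteHyperbolic_of_local hopen hconn.isPreconnected hbdd fun p hp ↦ ?_
  obtain ⟨V, hV, hpV, -, hVc, -⟩ := hvis p hp
  exact ⟨V, hV.mem_nhds hpV, hVc⟩
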